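/- All graphs are DAGs on one common finite node set $U$. The independence constraints implied by a DAG are those given by d-separation: for pairwise disjoint node sets, $X$ is independent of $Y$ given $Z$ if no node of $X$ is joined to a node of $Y$ by a $Z$-active path. We write $G\le H$ if every independence constraint implied by $H$ is also implied by $G$, and $G<H$ if moreover the two sets of constraints differ. If $G<H$, an edge $e$ of $H$ is *deletable* (in $H$ with respect to $G$) if $G\le H'$, where $H'$ is $H$ with $e$ removed. An edge $X\to Y$ is *covered* in $H$ if the parents of $Y$ are exactly $X$ and the parents of $X$. A node $N$ is a *proper descendant* of $Y$ if $N\neq Y$ and there is a directed path from $Y$ to $N$. Let $\mathbf V=\mathrm{Prune}(G,H)\subseteq U$ be the set of nodes that remain after repeatedly removing from both graphs any common sink (a node with no children in either current graph) that has the same parents in both, until no such node is left; the result does not depend on the order of removals. Let $G_{\mathbf V}$ and $H_{\mathbf V}$ be the induced subgraphs. **Theorem (deletion theorem).** Let $G$ and $H$ be DAGs with $G\le H$, let $\mathbf V=\mathrm{Prune}(G,H)$, and let $L\in\mathbf V$ be any $H_{\mathbf V}$-lowest $G_{\mathbf V}$-leaf, i.e. $L$ has no children in $G_{\mathbf V}$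 and no proper descendant of $L$ in $H_{\mathbf V}$ is a node without children in $G_{\mathbf V}$. Then: 1. If $L$ has no children in $H_{\mathbf V}$, then for every $D\in\mathbf V$ that is a parent of $L$ in $H_{\mathbf V}$ but not in $G_{\mathbf V}$, the edge $D\to L$ is deletable in $H$. 2. If $L$ has at least one child in $H_{\mathbf V}$, let $A$ be any highest one, i.e. a child of $L$ in $H_{\mathbf V}$ that is not a proper descendant in $H_{\mathbf V}$ of another child of $L$. Then at least one of the following holds in $H$: - (a) $L\to A$ is covered; - (b) there is an edge $B\to A$, with $B\ne L$ and $B$ not adjacent to $L$, such that $L\to A$ or $B\to A$ (or both) is deletable; - (c) there is an edge $D\to L$, with $D\ne A$ and $D$ not adjacent to $A$, such that $D\to L$ or $L\to A$ (or both) is deletable. -/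

import Mathlib

/-- A directed acyclic graph with node set `V`. -/
structure DAG (V : Type*) where
  edge : V → V → Prop
  acyclic : ∀ v, ¬ Relation.TransGen edge v v

namespace DAG

variable {V : Type*}

/-- Two nodes are adjacent if they are joined by an edge, in either direction. -/
def Adj (G : DAG V) (x y : V) : Prop := G.edge x y ∨ G.edge y x

/-- `d` is a descendant of `v` (every node is a descendant of itself). -/
def IsDescendant (G : DAG V) (v d : V) : Prop := Relation.ReflTransGen G.edge v d

def IsProperDescendant (G : DAG V) (v d : V) : Prop := G.IsDescendant v d ∧ d ≠ v

/-- A sink, or leaf: a node without children. -/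
def IsLeaf (G : DAG V) (v : V) : Prop := ∀ w, ¬ G.edge v w

/-- The subgraph induced by a set of nodes. -/
def induce (G : DAG V) (S : Set V) : DAG S where
  edge a b := G.edge a b
  acyclic v h := G.acyclic v (h.lift Subtype.val fun _ _ hab => hab)

/-- The DAG that results from removing the edge `x → y`. -/
def deleteEdge (G : DAG V) (x y : V) : DAG V where
  edge a b := G.edge a b ∧ ¬ (a = x ∧ b = y)
  acyclic v h := G.acyclic v (h.lift id fun _ _ hab => hab.1)

/-- `G.ActivePath S a u v`: there is an `S`-active path (not necessarily simple) with at least one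
edge that starts at `a` and whose last edge joins `u` to its end `v`. Every node `v` at an interior
position of the path, between `u` and `w`, lies in `S` if it is a collider `u → v ← w` at that
position, and lies outside `S` if it is not. -/
inductive ActivePath (G : DAG V) (S : Set V) (a : V) : V → V → Prop
  | single {b : V} : G.Adj a b → ActivePath G S a a b
  | step {u v w : V} : ActivePath G S a u v → G.Adj v w →
      ((G.edge u v ∧ G.edge w v) ↔ v ∈ S) → ActivePath G S a v w

/-- `a` and `b` are d-separated given `S`: there is no `S`-active path between them. -/
def DSep (G : DAG V) (a b : V) (S : Set V) : Prop := ∀ u, ¬ G.ActivePath S a u b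

/-- The DAG imposes the constraint that `X` is independent of `Y` given `Z`
(applied to pairwise disjoint sets only). -/
def Indep (G : DAG V) (X Y Z : Set V) : Prop := ∀ a ∈ X, ∀ b ∈ Y, G.DSep a b Z

/-- `G ≤ H`, i.e. `H` is an independence map of `G`: every independence constraint implied by `H`
is implied by `G`. -/
def IMapLE (G H : DAG V) : Prop :=
  ∀ X Y Z : Set V, Disjoint X Y → Disjoint X Z → Disjoint Y Z → H.Indep X Y Z → G.Indep X Y Z

/-- The independence constraints implied by the two DAGs are identical. -/
def Equivalent (G H : DAG V) : Prop :=
  ∀ X Y Z : Set V, Disjoint X Y → Disjoint X Z → Disjoint Y Z → (H.Indep X Y Z ↔ G.Indep X Y Z)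

/-- `G < H`. -/
def IMapLT (G H : DAG V) : Prop := IMapLE G H ∧ ¬ Equivalent G H

/-- The edge `x → y` of `H` is deletable in `H` with respect to `G`. -/
def Deletable (G H : DAG V) (x y : V) : Prop :=
  IMapLT G H ∧ H.edge x y ∧ IMapLE G (H.deleteEdge x y)

/-- The edge `x → y` is covered: `x` and `y` have the same parents, except for `x` itself. -/
def Covered (H : DAG V) (x y : V) : Prop :=
  H.edge x y ∧ ∀ p, H.edge p y ↔ (H.edge p x ∨ p = x)

/-- `L` is an `H`-lowest `G`-leaf. -/
def IsLowestLeaf (G H : DAG V) (L : V) : Prop :=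
  G.IsLeaf L ∧ ∀ d, H.IsProperDescendant L d → ¬ G.IsLeaf d

/-- `A` is a highest child of `L` in `H`: it is not a proper descendant of any child of `L`. -/
def IsHighestChild (H : DAG V) (L A : V) : Prop :=
  H.edge L A ∧ ∀ C, H.edge L C → ¬ H.IsProperDescendant C A

/-- After all nodes outside `S` have been removed from both DAGs, `v` is a common sink that has
the same parents in both. -/
def IsCommonSink (G H : DAG V) (S : Set V) (v : S) : Prop :=
  (G.induce S).IsLeaf v ∧ (H.induce S).IsLeaf v ∧
    ∀ p : S, (G.induce S).edge p v ↔ (H.induce S).edge p v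

/-- Removal of one common sink with the same parents in both graphs. -/
def PruneStep (G H : DAG V) (S T : Set V) : Prop :=
  ∃ v : S, IsCommonSink G H S v ∧ T = S \ {(v : V)}

/-- `S` is what remains after repeatedly removing common sinks with the same parents, starting
from all nodes, until there is no such node left. -/
def IsPruned (G H : DAG V) (S : Set V) : Prop :=
  Relation.ReflTransGen (PruneStep G H) Set.univ S ∧ ∀ v : S, ¬ IsCommonSink G H S v

/-- The order of the removals does not matter. -/
theorem existsUnique_isPruned [Finite V] (G H : DAG V) : ∃! S : Set V, IsPruned G H S := by
  have ex : ∀ (n : ℕ) (S : Set V), S.ncard = n →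
      Relation.ReflTransGen (PruneStep G H) Set.univ S → ∃ T, IsPruned G H T := by
    intro n
    induction n with
    | zero =>
      intro S hS h
      have : S = ∅ := (Set.ncard_eq_zero (Set.toFinite S)).1 hS
      subst this
      exact ⟨∅, h, fun v => v.2.elim⟩
    | succ n ih =>
      intro S hS h
      by_cases hv : ∃ v : S, IsCommonSink G H S v
      · obtain ⟨v, hv⟩ := hv
        refine ih (S \ {(v : V)}) ?_ (h.tail ⟨v, hv, rfl⟩)
        rw [Set.ncard_sdiff_singleton_of_mem v.2, hS]
        rfl
      · exact ⟨S, h, fun v h' => hv ⟨v, h'⟩⟩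
  have sub : ∀ S T : Set V, (∀ v : S, ¬ IsCommonSink G H S v) →
      Relation.ReflTransGen (PruneStep G H) Set.univ T → S ⊆ T := by
    intro S T hS hT
    induction hT with
    | refl => exact Set.subset_univ S
    | tail _ hstep ih =>
      obtain ⟨v, ⟨h1, h2, h3⟩, rfl⟩ := hstep
      intro x hx
      refine ⟨ih hx, ?_⟩
      rintro rfl
      exact hS ⟨v, hx⟩ ⟨fun w => h1 ⟨w, ih w.2⟩, fun w => h2 ⟨w, ih w.2⟩,
        fun p => h3 ⟨p, ih p.2⟩⟩
  obtain ⟨S, hS⟩ := ex _ Set.univ rfl Relation.ReflTransGen.refl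
  exact ⟨S, hS, fun T hT => (sub T S hT.2 hS.1).antisymm (sub S T hS.2 hT.1)⟩

/-- The pruned variables for `G` and `H`. -/
noncomputable def prune [Finite V] (G H : DAG V) : Set V := (existsUnique_isPruned G H).choose

theorem isPruned_prune [Finite V] (G H : DAG V) : IsPruned G H (prune G H) :=
  (existsUnique_isPruned G H).choose_spec.1

end DAG

/-!
d-separation is handled by active walks, which can be reversed, cut at the first visit to a set, and
joined at a common end.

An edge `x → y` of `H` is deletable as soon as `G` separates `x` from `y` by the other parents of
`y` in `H` (`DAG.IMapLE.deletable`). Indeed `G` then has the local Markov property for the smaller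
graph, and the local property implies the global one (`DAG.exists_activePathIn_of_local`, by
induction on ancestral sets). Since the nodes left by pruning form an ancestral set in both graphs, it suffices
to find such separations in the induced subgraphs (`DAG.IMapLE.deletable_of_induce`).

If `L` is a leaf in both graphs, every active walk that ends in `L` comes from a `G`-parent of `L`,
which is blocked by the `H`-parents (`DAG.dsep_of_isLeaf`).

Let `A` be a highest child of `L` with `L → A` not covered. Because `A` is highest, its parents other
than `L` are non-descendants of `L` in `H`.

* Suppose `B → A` with `B` not a parent of `L`, and neither `L → A` nor `B → A` is deletable
  (`DAG.dsep_or_dsep_of_parent_of_child`). Then `G` has active walks from `A` to `L` and to `B`. They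
  can be chosen active given the set `Z` of the parents of `L` and the other parents of `A`, since
  they cannot visit non-descendants of `L` that are not parents of `A`. As proper descendants
  of `L` are not leaves of `G`, a directed walk of `G` from `A` leaves these descendants. It
  must leave them at a parent of `A`, and this supplies either a walk from `A` to `L` or `B` that
  starts along an arrow, or an active collider below `A` (`DAG.exit_or_bounce`). In each case `L` and
  `B` are joined by a walk of `G` that is active given `Z`, while `H` separates them by `Z`.
* Otherwise some `D → L` has `D` not a parent of `A`. If neither `D → L` nor `L → A` is deletable,
  active walks of `G` from `A` and from `D` meet in a collider at the leaf `L`, and `H` forbids this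
  (`DAG.dsep_or_dsep_of_parent_of_leaf`).
-/

namespace DAG

variable {V : Type*}

/-! ### Active walks with restricted interior -/

/-- `G.ActivePathIn S I a u v`: an `S`-active walk from `a` to `v` with last edge between `u` and
`v`, all of whose interior nodes lie in `I`. -/
inductive ActivePathIn (G : DAG V) (S I : Set V) (a : V) : V → V → Prop
  | single {b : V} : G.Adj a b → ActivePathIn G S I a a b
  | step {u v w : V} : ActivePathIn G S I a u v → G.Adj v w →
      ((G.edge u v ∧ G.edge w v) ↔ v ∈ S) → v ∈ I → ActivePathIn G S I a v w

theorem Adj.symm {G : DAG V} {a b : V} (h : G.Adj a b) : G.Adj b a := Or.symm h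

theorem edge_asymm (G : DAG V) {a b : V} (h : G.edge a b) : ¬ G.edge b a :=
  fun h' => G.acyclic a ((Relation.TransGen.single h).tail h')

theorem not_edge_self (G : DAG V) (a : V) : ¬ G.edge a a :=
  fun h => G.acyclic a (.single h)

theorem not_isDescendant_of_edge (G : DAG V) {a b : V} (h : G.edge a b) :
    ¬ G.IsDescendant b a :=
  fun h' => G.acyclic a (Relation.TransGen.head' h h')

theorem ActivePathIn.toActivePath {G : DAG V} {S I : Set V} {a u b : V}
    (h : G.ActivePathIn S I a u b) : G.ActivePath S a u b := by
  induction h with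
  | single h => exact .single h
  | step _ h1 h2 _ ih => exact .step ih h1 h2

theorem ActivePath.toIn {G : DAG V} {S : Set V} {a u b : V}
    (h : G.ActivePath S a u b) : G.ActivePathIn S Set.univ a u b := by
  induction h with
  | single h => exact .single h
  | step _ h1 h2 ih => exact .step ih h1 h2 trivial

/-- Only the interior nodes of a walk matter for its activity. -/
theorem ActivePathIn.congr {G : DAG V} {S S' I I' : Set V} {a u b : V}
    (h : G.ActivePathIn S I a u b) (hI : I ⊆ I') (hS : ∀ v ∈ I, v ∈ S ↔ v ∈ S') :
    G.ActivePathIn S' I' a u b := by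
  induction h with
  | single h => exact .single h
  | step _ h1 h2 h3 ih => exact .step ih h1 (h2.trans (hS _ h3)) (hI h3)

/-- Two active walks with a common end `m` are joined to one active walk if `m` satisfies the
condition on interior nodes. -/
theorem ActivePathIn.join {G : DAG V} {S I : Set V} {a b u₁ u₂ m : V}
    (h₁ : G.ActivePathIn S I a u₁ m) (h₂ : G.ActivePathIn S I b u₂ m)
    (hm : (G.edge u₁ m ∧ G.edge u₂ m) ↔ m ∈ S) (hI : m ∈ I) :
    ∃ u, G.ActivePathIn S I a u b := by
  induction h₂ generalizing u₁ with
  | single h => exact ⟨_, .step h₁ h.symm hm hI⟩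
  | step _ h1 h2 h3 ih => exact ih (.step h₁ h1.symm hm hI) (and_comm.trans h2) h3

theorem ActivePathIn.symm {G : DAG V} {S I : Set V} {a u b : V}
    (h : G.ActivePathIn S I a u b) : ∃ w, G.ActivePathIn S I b w a := by
  cases h with
  | single h => exact ⟨_, .single h.symm⟩
  | step h h1 h2 h3 =>
    exact ActivePathIn.join (.single h1.symm) h (and_comm.trans h2) h3

/-- A walk either avoids `Q` in its interior or has an initial segment that ends in `Q` and avoids
`Q` in its interior. -/
theorem ActivePathIn.firstHit {G : DAG V} {S I : Set V} {a u b : V}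
    (h : G.ActivePathIn S I a u b) (Q : Set V) :
    G.ActivePathIn S (I \ Q) a u b ∨
      ∃ q ∈ Q, q ∈ I ∧ ∃ w, G.ActivePathIn S (I \ Q) a w q := by
  induction h with
  | single h => exact .inl (.single h)
  | @step u v w _ h1 h2 h3 ih =>
    rcases ih with ih | ih
    · by_cases hv : v ∈ Q
      · exact .inr ⟨v, hv, h3, _, ih⟩
      · exact .inl (.step ih h1 h2 ⟨h3, hv⟩)
    · exact .inr ih

theorem DSep.symm {G : DAG V} {a b : V} {S : Set V} (h : G.DSep a b S) : G.DSep b a S := by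
  intro u hu
  obtain ⟨w, hw⟩ := hu.toIn.symm
  exact h w hw.toActivePath

theorem DSep.false_of_in {G : DAG V} {a u b : V} {S I : Set V} (h : G.DSep a b S)
    (hp : G.ActivePathIn S I a u b) : False := h u hp.toActivePath

/-! ### Independence maps and the local Markov property -/

theorem IMapLE.dsep {G H : DAG V} (h : IMapLE G H) {a b : V} {S : Set V} (hab : a ≠ b)
    (ha : a ∉ S) (hb : b ∉ S) (hs : H.DSep a b S) : G.DSep a b S := by
  refine h {a} {b} S (by simpa using hab) (by simpa using ha) (by simpa using hb) ?_ a rfl b rfl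
  rintro _ rfl _ rfl
  exact hs

theorem imapLE_of_dsep {G H : DAG V}
    (h : ∀ a b S, a ≠ b → a ∉ S → b ∉ S → H.DSep a b S → G.DSep a b S) : IMapLE G H := by
  intro X Y Z h1 h2 h3 hi a ha b hb
  exact h a b Z (fun e => Set.disjoint_left.1 h1 ha (e ▸ hb)) (Set.disjoint_left.1 h2 ha)
    (Set.disjoint_left.1 h3 hb) (hi a ha b hb)

/-- A node is separated from a non-descendant by any set of non-descendants that contains all its
parents: a walk that starts downwards can never turn, and one that starts upwards is blocked at
once. -/
theorem dsep_of_parents_subset (H : DAG V) {v x : V} {Z : Set V}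
    (hpa : ∀ p, H.edge p v → p ∈ Z) (hZ : ∀ z ∈ Z, ¬ H.IsDescendant v z)
    (hx : ¬ H.IsDescendant v x) (hxZ : x ∉ Z) : H.DSep v x Z := by
  have key : ∀ u b, H.ActivePath Z v u b →
      (H.edge u b ∧ H.IsDescendant v u) ∨ (u = v ∧ H.edge b v) := by
    intro u b h
    induction h with
    | single h => exact h.imp (fun h => ⟨h, .refl⟩) (fun h => ⟨rfl, h⟩)
    | @step u b w _ h1 h2 ih =>
      rcases ih with ⟨he, hd⟩ | ⟨rfl, he⟩
      · have hb : H.IsDescendant v b := hd.tail he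
        have : ¬ H.edge w b := fun hw => hZ b (h2.1 ⟨he, hw⟩) hb
        exact .inl ⟨h1.resolve_right this, hb⟩
      · exact absurd (h2.2 (hpa _ he)).1 (H.edge_asymm he)
  intro u hu
  rcases key u x hu with ⟨he, hd⟩ | ⟨rfl, he⟩
  · exact hx (hd.tail he)
  · exact hxZ (hpa _ he)

theorem IMapLE.dsep_of_parents_subset {G H : DAG V} (hGH : IMapLE G H) {v x : V} {Z : Set V}
    (hpa : ∀ p, H.edge p v → p ∈ Z) (hZ : ∀ z ∈ Z, ¬ H.IsDescendant v z)
    (hx : ¬ H.IsDescendant v x) (hxZ : x ∉ Z) : G.DSep v x Z :=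
  hGH.dsep (by rintro rfl; exact hx .refl) (fun h => hZ v h .refl) hxZ
    (H.dsep_of_parents_subset hpa hZ hx hxZ)

/-- A set of nodes that contains all parents of its members. -/
def IsAncestral (G : DAG V) (T : Set V) : Prop := ∀ a b, G.edge a b → b ∈ T → a ∈ T

theorem IsAncestral.mem_of_isDescendant {G : DAG V} {T : Set V} (hT : G.IsAncestral T) {a b : V}
    (h : G.IsDescendant a b) (hb : b ∈ T) : a ∈ T := by
  induction h using Relation.ReflTransGen.head_induction_on with
  | refl => exact hb
  | head h _ ih => exact hT _ _ h ih

theorem wellFounded_child [Finite V] (G : DAG V) : WellFounded fun c x => G.edge x c := by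
  have : Std.Irrefl (fun c x => Relation.TransGen G.edge x c) := ⟨fun a => G.acyclic a⟩
  have : IsTrans V (fun c x => Relation.TransGen G.edge x c) := ⟨fun a b c h1 h2 => h2.trans h1⟩
  exact Subrelation.wf (fun h => Relation.TransGen.single h)
    (Finite.wellFounded_of_trans_of_irrefl (fun c x => Relation.TransGen G.edge x c))

/-- The local Markov property implies the global one. Here `K` is a subgraph of `H`, and the local
property is only required for non-descendants in `H`. The induction removes a sink of `H` from an
ancestral set `T`; it turns `G`-active walks into `K`-active ones. -/
theorem exists_activePathIn_of_local [Finite V] {G H K : DAG V}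
    (hKH : ∀ a b, K.edge a b → H.edge a b)
    (hloc : ∀ v x Z, (∀ p, K.edge p v → p ∈ Z) → (∀ z ∈ Z, ¬ H.IsDescendant v z) →
      ¬ H.IsDescendant v x → x ∉ Z → G.DSep v x Z) (n : ℕ) :
    ∀ T : Set V, T.ncard = n → H.IsAncestral T → ∀ S ⊆ T, ∀ a ∈ T, ∀ b ∈ T, a ≠ b → a ∉ S →
      b ∉ S → ∀ u, G.ActivePath S a u b → ∃ w, K.ActivePathIn S T a w b := by
  induction n with
  | zero =>
    intro T hT _ S _ a ha
    rw [Set.ncard_eq_zero] at hT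
    exact absurd ha (by simp [hT])
  | succ n ih =>
    intro T hT hanc S hS a ha b hb hab haS hbS u hu
    obtain ⟨v, hvT, hv⟩ := H.wellFounded_child.has_min T ⟨a, ha⟩
    have hv' : ∀ w ∈ T, w ≠ v → ¬ H.IsDescendant v w := by
      intro w hw hwv hd
      rcases Relation.ReflTransGen.cases_head hd with h | ⟨c, hc, hcw⟩
      · exact hwv h.symm
      · exact hv c (hanc.mem_of_isDescendant hcw hw) hc
    have hanc' : H.IsAncestral (T \ {v}) := by
      intro x y hxy hy
      refine ⟨hanc x y hxy hy.1, ?_⟩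
      rintro rfl
      exact hv y hy.1 hxy
    have IH := ih (T \ {v}) (by rw [Set.ncard_sdiff_singleton_of_mem hvT, hT]; rfl) hanc'
    have hsub : T \ {v} ⊆ T := Set.sdiff_subset
    -- A `G`-active walk to the sink yields a `K`-active walk through one of its parents.
    have reach : ∀ S ⊆ T \ {v}, ∀ b ∈ T \ {v}, b ∉ S → ∀ u, G.ActivePath S b u v →
        ∃ w, K.edge w v ∧ K.ActivePathIn S (T \ {v}) b w v := by
      intro S hS b hb hbS u hu
      by_cases hbv : K.edge b v
      · exact ⟨b, hbv, .single (.inl hbv)⟩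
      have hpT : ∀ p, K.edge p v → p ∈ T \ {v} := by
        intro p hp
        refine ⟨hanc p v (hKH _ _ hp) hvT, ?_⟩
        rintro rfl
        exact K.not_edge_self _ hp
      rcases hu.toIn.firstHit ({p | K.edge p v} \ S) with h | ⟨p, ⟨hpv, hpS⟩, -, w, hw⟩
      · refine ((hloc v b (S ∪ {p | K.edge p v}) (fun p hp => .inr hp) ?_
          (hv' b hb.1 hb.2) ?_).symm.false_of_in (h.congr (Set.subset_univ _) ?_)).elim
        · rintro z (hz | hz)
          · exact hv' z (hS hz).1 (hS hz).2
          · exact hv' z (hpT z hz).1 (hpT z hz).2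
        · rintro (h | h)
          exacts [hbS h, hbv h]
        · rintro z ⟨-, hz⟩
          simp only [Set.mem_sdiff, Set.mem_ofPred_eq, not_and, not_not] at hz
          exact ⟨.inl, fun h => h.elim id hz⟩
      · obtain ⟨w', hw'⟩ := IH S hS b hb p (hpT p hpv) (by rintro rfl; exact hbv hpv) hbS hpS w
          hw.toActivePath
        refine ⟨p, hpv, .step hw' (.inl hpv) ?_ (hpT p hpv)⟩
        exact iff_of_false (fun h => K.edge_asymm hpv h.2) hpS
    by_cases hvS : v ∈ S
    · have hav : a ≠ v := by rintro rfl; exact haS hvS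
      have hbv : b ≠ v := by rintro rfl; exact hbS hvS
      have hS' : S \ {v} ⊆ T \ {v} := Set.sdiff_subset_sdiff_left hS
      have hagree : ∀ x ∈ Set.univ \ {v}, x ∈ S ↔ x ∈ S \ {v} := by
        rintro x ⟨-, hx⟩
        exact ⟨fun h => ⟨h, hx⟩, fun h => h.1⟩
      have hagree' : ∀ x ∈ T \ {v}, x ∈ S \ {v} ↔ x ∈ S :=
        fun x hx => (hagree x ⟨trivial, hx.2⟩).symm
      have avoid : ∀ u, G.ActivePathIn S (Set.univ \ {v}) a u b →
          ∃ w, K.ActivePathIn S T a w b := by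
        intro u h
        obtain ⟨w, hw⟩ := IH _ hS' a ⟨ha, hav⟩ b ⟨hb, hbv⟩ hab (fun h => haS h.1)
          (fun h => hbS h.1) u (h.congr subset_rfl hagree).toActivePath
        exact ⟨w, hw.congr hsub hagree'⟩
      rcases hu.toIn.firstHit {v} with h | ⟨q, rfl, -, w₁, hw₁⟩
      · exact avoid _ h
      · obtain ⟨u', hu'⟩ := hu.toIn.symm
        rcases hu'.firstHit {q} with h | ⟨_, rfl, -, w₂, hw₂⟩
        · obtain ⟨_, h'⟩ := h.symm
          exact avoid _ h'
        · obtain ⟨p₁, hp₁, hk₁⟩ := reach _ hS' a ⟨ha, hav⟩ (fun h => haS h.1) _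
            (hw₁.congr subset_rfl hagree).toActivePath
          obtain ⟨p₂, hp₂, hk₂⟩ := reach _ hS' b ⟨hb, hbv⟩ (fun h => hbS h.1) _
            (hw₂.congr subset_rfl hagree).toActivePath
          exact (hk₁.congr hsub hagree').join (hk₂.congr hsub hagree')
            (iff_of_true ⟨hp₁, hp₂⟩ hvS) hvT
    · have hS' : S ⊆ T \ {v} := Set.subset_sdiff_singleton hS hvS
      by_cases hav : a = v
      · subst hav
        obtain ⟨u', hu'⟩ := hu.toIn.symm
        obtain ⟨w, -, hw⟩ := reach S hS' b ⟨hb, hab.symm⟩ hbS u' hu'.toActivePath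
        exact (hw.congr hsub fun _ _ => Iff.rfl).symm
      · by_cases hbv : b = v
        · subst hbv
          obtain ⟨w, -, hw⟩ := reach S hS' a ⟨ha, hab⟩ haS u hu
          exact ⟨w, hw.congr hsub fun _ _ => Iff.rfl⟩
        · obtain ⟨w, hw⟩ := IH S hS' a ⟨ha, hav⟩ b ⟨hb, hbv⟩ hab haS hbS u hu
          exact ⟨w, hw.congr hsub fun _ _ => Iff.rfl⟩

/-- The edge `x → y` can be removed from `H` if `G` separates `x` from `y` by the other parents of
`y`: by contraction `G` then has the local Markov property for the smaller graph. -/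
theorem IMapLE.deleteEdge [Finite V] {G H : DAG V} (hGH : IMapLE G H) {x y : V}
    (hxy : H.edge x y) (h : G.DSep y x {p | H.edge p y ∧ p ≠ x}) :
    IMapLE G (H.deleteEdge x y) := by
  have hloc : ∀ v b Z, (∀ p, (H.deleteEdge x y).edge p v → p ∈ Z) →
      (∀ z ∈ Z, ¬ H.IsDescendant v z) → ¬ H.IsDescendant v b → b ∉ Z → G.DSep v b Z := by
    intro v b Z hpa hZ hb hbZ
    by_cases hfull : ∀ p, H.edge p v → p ∈ Z
    · exact hGH.dsep_of_parents_subset hfull hZ hb hbZ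
    push Not at hfull
    obtain ⟨p, hpv, hpZ⟩ := hfull
    have hp : p = x ∧ v = y := by
      by_contra hne
      exact hpZ (hpa p ⟨hpv, hne⟩)
    obtain ⟨rfl, rfl⟩ := hp
    have hsub : ∀ q, H.edge q v → q ≠ p → q ∈ Z := fun q hq hqp =>
      hpa q ⟨hq, fun h => hqp h.1⟩
    -- First half of contraction: `v` and `p` stay separated when `Z` replaces the other parents.
    have hvp : G.DSep v p Z := by
      intro u hu
      set P : Set V := {q | H.edge q v ∧ q ≠ p} with hP
      have key : ∀ c w, c = p ∨ c ∈ Z \ P →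
          ¬ G.ActivePathIn Z (Set.univ \ ({p} ∪ Z \ P)) v w c := by
        intro c w hc hw
        have hag : ∀ z ∈ Set.univ \ ({p} ∪ Z \ P), z ∈ Z ↔ z ∈ P := by
          rintro z ⟨-, hz⟩
          refine ⟨fun hzZ => ?_, fun hzP => hsub z hzP.1 hzP.2⟩
          by_contra hzP
          exact hz (.inr ⟨hzZ, hzP⟩)
        rcases hc with rfl | hc
        · exact h.false_of_in (hw.congr subset_rfl hag)
        · refine (hGH.dsep_of_parents_subset (v := v) (x := c) (Z := {q | H.edge q v})
            (fun _ h => h) (fun z hz => H.not_isDescendant_of_edge hz) (hZ c hc.1)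
            ?_).false_of_in (hw.congr subset_rfl ?_)
          · intro hcv
            exact hc.2 ⟨hcv, by rintro rfl; exact hpZ hc.1⟩
          · intro z hz
            rw [hag z hz]
            exact ⟨fun h => h.1, fun h => ⟨h, fun e => hz.2 (.inl e)⟩⟩
      rcases hu.toIn.firstHit ({p} ∪ Z \ P) with hw | ⟨c, hc, -, w, hw⟩
      · exact key p u (.inl rfl) hw
      · exact key c w hc hw
    intro u hu
    rcases hu.toIn.firstHit {p} with hw | ⟨_, rfl, -, w, hw⟩
    · by_cases hbp : b = p
      · subst hbp
        exact hvp u hu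
      refine (hGH.dsep_of_parents_subset (v := v) (x := b) (Z := insert p Z) ?_ ?_ hb
        ?_).false_of_in (hw.congr subset_rfl ?_)
      · intro q hq
        by_cases hqp : q = p
        exacts [.inl hqp, .inr (hsub q hq hqp)]
      · rintro z (rfl | hz)
        exacts [H.not_isDescendant_of_edge hpv, hZ z hz]
      · rintro (h | h)
        exacts [hbp h, hbZ h]
      · rintro z ⟨-, hz⟩
        exact ⟨.inr, fun h => h.resolve_left hz⟩
    · exact hvp.false_of_in hw
  refine imapLE_of_dsep fun a b S hab ha hb hs u hu => ?_
  obtain ⟨w, hw⟩ := exists_activePathIn_of_local (K := H.deleteEdge x y) (fun _ _ h => h.1) hloc _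
    Set.univ rfl (fun _ _ _ _ => trivial) S (Set.subset_univ S) a trivial b trivial hab ha hb u hu
  exact hs.false_of_in hw

theorem IMapLE.deletable [Finite V] {G H : DAG V} (hGH : IMapLE G H) {x y : V}
    (hxy : H.edge x y) (h : G.DSep y x {p | H.edge p y ∧ p ≠ x}) : Deletable G H x y := by
  refine ⟨⟨hGH, fun heq => ?_⟩, hxy, hGH.deleteEdge hxy h⟩
  have hsub : IMapLE H G := fun X Y Z h1 h2 h3 => (heq X Y Z h1 h2 h3).2
  have hyx : y ≠ x := by rintro rfl; exact H.not_edge_self _ hxy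
  exact hsub.dsep hyx (fun h => H.not_edge_self _ h.1) (fun h => h.2 rfl) h y (.single (.inr hxy))

/-! ### Restriction to ancestral sets -/

theorem ActivePath.of_induce {G : DAG V} {T : Set V} {S : Set T} {a u b : T}
    (h : (G.induce T).ActivePath S a u b) : G.ActivePath (Subtype.val '' S) a u b := by
  induction h with
  | single h => exact .single h
  | step _ h1 h2 ih => exact .step ih h1 (h2.trans (by simp))

/-- An active walk between members of an ancestral set that contains the conditioning set does not
leave it: below the set, the walk could only descend for ever. -/
theorem ActivePath.to_induce {G : DAG V} {T : Set V} (hT : G.IsAncestral T) {S : Set T}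
    {a b : T} {u : V} (h : G.ActivePath (Subtype.val '' S) a u b) :
    ∃ w, (G.induce T).ActivePath S a w b := by
  have key : ∀ u b, G.ActivePath (Subtype.val '' S) a u b →
      (∃ hu : u ∈ T, ∃ hb : b ∈ T, (G.induce T).ActivePath S a ⟨u, hu⟩ ⟨b, hb⟩) ∨
        (G.edge u b ∧ b ∉ T) := by
    intro u b h
    induction h with
    | @single b h =>
      by_cases hb : b ∈ T
      · exact .inl ⟨a.2, hb, .single h⟩
      · exact .inr ⟨h.resolve_right fun h => hb (hT _ _ h a.2), hb⟩
    | @step u v w _ h1 h2 ih =>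
      rcases ih with ⟨hu, hv, ih⟩ | ⟨he, hv⟩
      · by_cases hw : w ∈ T
        · exact .inl ⟨hv, hw, .step ih h1 (h2.trans (by simp [hv]))⟩
        · exact .inr ⟨h1.resolve_right fun h => hw (hT _ _ h hv), hw⟩
      · have hvS : v ∉ Subtype.val '' S := by
          rintro ⟨s, -, rfl⟩
          exact hv s.2
        have hvw : G.edge v w := h1.resolve_right fun h => hvS (h2.1 ⟨he, h⟩)
        exact .inr ⟨hvw, fun hw => hv (hT _ _ hvw hw)⟩
  rcases key u b h with ⟨hu, hb, h⟩ | ⟨-, hb⟩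
  · exact ⟨_, h⟩
  · exact absurd b.2 hb

theorem dsep_induce_iff {G : DAG V} {T : Set V} (hT : G.IsAncestral T) {S : Set T} {a b : T} :
    (G.induce T).DSep a b S ↔ G.DSep a b (Subtype.val '' S) := by
  refine ⟨fun h u hu => ?_, fun h u hu => h u hu.of_induce⟩
  obtain ⟨w, hw⟩ := hu.to_induce hT
  exact h w hw

theorem IMapLE.induce {G H : DAG V} (hGH : IMapLE G H) {T : Set V} (hG : G.IsAncestral T)
    (hH : H.IsAncestral T) : IMapLE (G.induce T) (H.induce T) := by
  refine imapLE_of_dsep fun a b S hab ha hb h => ?_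
  rw [dsep_induce_iff hG]
  rw [dsep_induce_iff hH] at h
  exact hGH.dsep (fun e => hab (Subtype.ext e)) (by simpa using ha) (by simpa using hb) h

/-- Separation in the induced subgraphs suffices for an edge of the large graph to be deletable. -/
theorem IMapLE.deletable_of_induce [Finite V] {G H : DAG V} (hGH : IMapLE G H) {T : Set V}
    (hG : G.IsAncestral T) (hH : H.IsAncestral T) {x y : T} (hxy : H.edge x y)
    (h : (G.induce T).DSep y x {p | (H.induce T).edge p y ∧ p ≠ x}) : Deletable G H x y := by
  refine hGH.deletable hxy ?_
  rw [dsep_induce_iff hG] at h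
  convert h using 1
  ext p
  constructor
  · rintro ⟨h1, h2⟩
    exact ⟨⟨p, hH _ _ h1 y.2⟩, ⟨h1, fun e => h2 (congrArg Subtype.val e)⟩, rfl⟩
  · rintro ⟨p, ⟨h1, h2⟩, rfl⟩
    exact ⟨h1, fun e => h2 (Subtype.ext e)⟩

theorem isAncestral_prune [Finite V] (G H : DAG V) :
    G.IsAncestral (prune G H) ∧ H.IsAncestral (prune G H) := by
  have h := (isPruned_prune G H).1
  generalize prune G H = T at h
  induction h with
  | refl => exact ⟨fun _ _ _ _ => trivial, fun _ _ _ _ => trivial⟩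
  | tail _ hstep ih =>
    obtain ⟨v, ⟨h1, h2, -⟩, rfl⟩ := hstep
    refine ⟨fun a b hab hb => ⟨ih.1 a b hab hb.1, ?_⟩, fun a b hab hb => ⟨ih.2 a b hab hb.1, ?_⟩⟩
    · rintro rfl
      exact h1 ⟨b, hb.1⟩ hab
    · rintro rfl
      exact h2 ⟨b, hb.1⟩ hab

/-! ### Edges at a lowest leaf -/

/-- A leaf of `G` is separated in `G` from every non-neighbour by the remaining nodes among its
parents in `H`, if it is a leaf of `H` too. -/
theorem dsep_of_isLeaf {G H : DAG V} (hGH : IMapLE G H) {L D : V} (hG : G.IsLeaf L)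
    (hH : H.IsLeaf L) (hD : ¬ G.edge D L) : G.DSep L D {p | H.edge p L ∧ p ≠ D} := by
  have hdesc : ∀ z, H.IsDescendant L z → z = L := by
    intro z hz
    rcases Relation.ReflTransGen.cases_head hz with h | ⟨c, hc, -⟩
    exacts [h.symm, (hH c hc).elim]
  have hpar : ∀ p, G.edge p L → H.edge p L := by
    intro p hp
    by_contra hpH
    have hpL : ¬ H.IsDescendant L p := fun h => G.not_edge_self L (hdesc p h ▸ hp)
    exact hGH.dsep_of_parents_subset (Z := {q | H.edge q L}) (fun _ h => h)
      (fun z hz => H.not_isDescendant_of_edge hz) hpL hpH L (.single (.inr hp))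
  intro u hu
  obtain ⟨w, hw⟩ := hu.toIn.symm
  cases hw with
  | single h => exact h.elim hD (hG D)
  | step _ h1 h2 _ =>
    have h1' := h1.resolve_right (hG _)
    have hne : w ≠ D := by rintro rfl; exact hD h1'
    exact hG _ (h2.2 ⟨hpar _ h1', hne⟩).2

/-- If a set `De` contains no leaf of `G`, then a directed walk that starts in it leaves it
eventually. Either such a walk leaves it at a node outside `Z`, or every walk that enters `x` by
an arrow can be continued, through a collider in `Z`, so that it returns to `x` against an arrow
out of `x`. -/
theorem exit_or_bounce [Finite V] (G : DAG V) {De Z : Set V} (hDe : ∀ x ∈ De, ¬ G.IsLeaf x)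
    (hZ : ∀ x ∈ De, x ∉ Z) (x : V) (hx : x ∈ De) :
    (∃ w, w ∉ De ∧ w ∉ Z ∧ ∃ c, G.edge x c ∧ G.ActivePathIn Z De w c x) ∨
      ∀ a u, G.edge u x → G.ActivePathIn Z Set.univ a u x →
        ∃ c, G.edge x c ∧ G.ActivePathIn Z Set.univ a c x := by
  induction x using G.wellFounded_child.induction with
  | _ x ih =>
    obtain ⟨c, hc⟩ : ∃ c, G.edge x c := by
      by_contra h
      exact hDe x hx fun c hc => h ⟨c, hc⟩
    have down : ∀ a u, G.ActivePathIn Z Set.univ a u x → G.ActivePathIn Z Set.univ a x c :=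
      fun a u h => .step h (.inl hc) (iff_of_false (fun h => G.edge_asymm hc h.2) (hZ x hx)) trivial
    by_cases hcDe : c ∈ De
    · rcases ih c hc hcDe with ⟨w, h1, h2, d, hd, hw⟩ | h
      · exact .inl ⟨w, h1, h2, c, hc, .step hw (.inr hc)
          (iff_of_false (fun h => G.edge_asymm hd h.1) (hZ c hcDe)) hcDe⟩
      · refine .inr fun a u _ hu => ?_
        obtain ⟨d, hd, hw⟩ := h a x hc (down a u hu)
        exact ⟨c, hc, .step hw (.inr hc)
          (iff_of_false (fun h => G.edge_asymm hd h.1) (hZ c hcDe)) trivial⟩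
    · by_cases hcZ : c ∈ Z
      · exact .inr fun a u _ hu => ⟨c, hc, .step (down a u hu) (.inr hc)
          (iff_of_true ⟨hc, hc⟩ hcZ) trivial⟩
      · exact .inl ⟨c, hcDe, hcZ, c, hc, .single (.inr hc)⟩

/-- A walk from `A` to `x` that is active given `S` can be chosen active given `Z`, if `Z` agrees
with `S` except on `N ∪ {x, y}`, no node of `N` is reached from `A` given `insert x S`, and `x`
and `y` are separated by `Z`. -/
theorem exists_activePathIn_of_agree {G : DAG V} {A x y u : V} {S Z N : Set V}
    (h : G.ActivePath S A u x) (hN : ∀ q ∈ N, G.DSep A q (insert x S))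
    (hag : ∀ v, v ∉ N → v ≠ x → v ≠ y → (v ∈ S ↔ v ∈ Z)) (hxy : G.DSep x y Z) :
    ∃ w, G.ActivePathIn Z (Set.univ \ {x}) A w x := by
  have hx : ∃ w, G.ActivePathIn S (Set.univ \ {x}) A w x := by
    rcases h.toIn.firstHit {x} with h | ⟨_, rfl, -, w, h⟩
    exacts [⟨_, h⟩, ⟨_, h⟩]
  obtain ⟨w, hw⟩ := hx
  rcases hw.firstHit N with hw | ⟨q, hq, -, w', hw⟩
  · obtain ⟨w', hw'⟩ := hw.symm
    have hag' : ∀ v ∈ ((Set.univ \ {x}) \ N) \ {y}, v ∈ S ↔ v ∈ Z :=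
      fun v hv => hag v hv.1.2 hv.1.1.2 hv.2
    rcases hw'.firstHit {y} with h | ⟨_, rfl, -, w'', h⟩
    · exact (h.congr (fun v hv => hv.1.1) hag').symm
    · exact (hxy.false_of_in (h.congr subset_rfl hag')).elim
  · refine ((hN q hq).false_of_in (hw.congr subset_rfl ?_)).elim
    rintro v ⟨⟨-, hv⟩, -⟩
    exact ⟨.inr, fun h => h.resolve_left hv⟩

theorem IsHighestChild.not_isProperDescendant_of_edge {H : DAG V} {L A p : V}
    (hA : H.IsHighestChild L A) (hp : H.edge p A) : ¬ H.IsProperDescendant L p := by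
  rintro ⟨hd, hne⟩
  rcases Relation.ReflTransGen.cases_head hd with h | ⟨c, hc, hcp⟩
  · exact hne h.symm
  · refine hA.2 c hc ⟨hcp.tail hp, ?_⟩
    rintro rfl
    exact H.not_isDescendant_of_edge hp hcp

/-- The highest child `A` of `L` is separated from all non-descendants of `L` by its parents. -/
theorem IsHighestChild.dsep {G H : DAG V} (hGH : IMapLE G H) {L A q : V}
    (hA : H.IsHighestChild L A) (hq : ¬ H.IsDescendant L q) (hqA : ¬ H.edge q A) :
    G.DSep A q {p | H.edge p A} :=
  hGH.dsep_of_parents_subset (fun _ h => h) (fun _ hz => H.not_isDescendant_of_edge hz)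
    (fun h => hq (Relation.ReflTransGen.head hA.1 h)) hqA

/-- If `B → A` is an edge from a node that is not a parent of `L`, then one of the edges `L → A`
and `B → A` is deletable. Otherwise `G`-active walks from `A` to `L` and to `B` could be joined at
`A` to a walk that is active given the parents of `L` and the other parents of `A`, although `H`
separates `L` and `B` by this set. -/
theorem dsep_or_dsep_of_parent_of_child [Finite V] {G H : DAG V} (hGH : IMapLE G H) {L A B : V}
    (hL : IsLowestLeaf G H L) (hA : H.IsHighestChild L A) (hBA : H.edge B A) (hBL : B ≠ L)
    (hB : ¬ H.edge B L) :
    G.DSep A L {p | H.edge p A ∧ p ≠ L} ∨ G.DSep A B {p | H.edge p A ∧ p ≠ B} := by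
  by_contra hcon
  push Not at hcon
  obtain ⟨hAL, hAB⟩ := hcon
  simp only [DSep, not_forall, not_not] at hAL hAB
  obtain ⟨u₁, h₁⟩ := hAL
  obtain ⟨u₂, h₂⟩ := hAB
  have hpaA : ∀ p, H.edge p A → p ≠ L → ¬ H.IsDescendant L p :=
    fun p hp hpL hd => hA.not_isProperDescendant_of_edge hp ⟨hd, hpL⟩
  set Z : Set V := {p | (H.edge p A ∧ p ≠ L ∧ p ≠ B) ∨ H.edge p L} with hZdef
  have hZL : ∀ z ∈ Z, ¬ H.IsDescendant L z := by
    rintro z (⟨h1, h2, -⟩ | h)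
    exacts [hpaA z h1 h2, H.not_isDescendant_of_edge h]
  have hBZ : B ∉ Z := by
    rintro (h | h)
    exacts [h.2.2 rfl, hB h]
  have hLB : G.DSep L B Z :=
    hGH.dsep_of_parents_subset (fun p hp => .inr hp) hZL (hpaA B hBA hBL) hBZ
  set N : Set V := {q | ¬ H.IsDescendant L q ∧ ¬ H.edge q A} with hN
  have hNA : ∀ q ∈ N, G.DSep A q {p | H.edge p A} := fun q hq => hA.dsep hGH hq.1 hq.2
  have hins : ∀ x, H.edge x A → insert x {p | H.edge p A ∧ p ≠ x} = {p | H.edge p A} := by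
    intro x hx
    ext p
    by_cases hp : p = x
    · simp [hp, hx]
    · simp [hp]
  have hag : ∀ v, v ∉ N → v ≠ L → v ≠ B → (H.edge v A ↔ v ∈ Z) := by
    intro v hvN hvL hvB
    refine ⟨fun h => .inl ⟨h, hvL, hvB⟩, ?_⟩
    rintro (h | h)
    · exact h.1
    · by_contra hvA
      exact hvN ⟨H.not_isDescendant_of_edge h, hvA⟩
  obtain ⟨w₁, hw₁⟩ := exists_activePathIn_of_agree (Z := Z) (N := N) (y := B) h₁
    (by rw [hins L hA.1]; exact hNA)
    (fun v hvN hvL hvB => by rw [← hag v hvN hvL hvB]; simp [hvL]) hLB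
  obtain ⟨w₂, hw₂⟩ := exists_activePathIn_of_agree (Z := Z) (N := N) (y := L) h₂
    (by rw [hins B hBA]; exact hNA)
    (fun v hvN hvB hvL => by rw [← hag v hvN hvL hvB]; simp [hvB]) hLB.symm
  obtain ⟨v₁, hv₁⟩ := (hw₁.congr (Set.subset_univ _) fun _ _ => Iff.rfl).symm
  obtain ⟨v₂, hv₂⟩ := (hw₂.congr (Set.subset_univ _) fun _ _ => Iff.rfl).symm
  set De : Set V := {d | H.IsProperDescendant L d} with hDe
  have hAL' : A ≠ L := by
    rintro rfl
    exact H.not_edge_self _ hA.1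
  have hADe : A ∈ De := ⟨.single hA.1, hAL'⟩
  have hAZ : A ∉ Z := fun h => hZL A h (.single hA.1)
  rcases G.exit_or_bounce (De := De) (Z := Z) hL.2 (fun x hx h => hZL x h hx.1) A hADe with
    ⟨w, hwDe, hwZ, c, hAc, hw⟩ | hbounce
  · have hw' := hw.congr (Set.subset_univ De) (fun _ _ => Iff.rfl)
    have hno : ∀ u, ¬ (G.edge c A ∧ G.edge u A) := fun u h => G.edge_asymm hAc h.1
    by_cases hwL : w = L
    · subst hwL
      obtain ⟨_, h⟩ := hw'.join hv₂ (iff_of_false (hno _) hAZ) trivial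
      exact hLB.false_of_in h
    by_cases hwB : w = B
    · subst hwB
      obtain ⟨_, h⟩ := hw'.join hv₁ (iff_of_false (hno _) hAZ) trivial
      exact hLB.symm.false_of_in h
    · have hwN : w ∈ N := ⟨fun h => hwDe ⟨h, hwL⟩, fun h => hwZ (.inl ⟨h, hwL, hwB⟩)⟩
      refine (hNA w hwN).symm.false_of_in (hw.congr subset_rfl fun v hv => ?_)
      refine iff_of_false (fun h => hZL v h hv.1) fun h => ?_
      exact hA.not_isProperDescendant_of_edge h hv
  · by_cases hcol : G.edge v₁ A ∧ G.edge v₂ A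
    · obtain ⟨c, hAc, hc⟩ := hbounce L v₁ hcol.1 hv₁
      obtain ⟨_, h⟩ := hc.join hv₂ (iff_of_false (fun h => G.edge_asymm hAc h.1) hAZ) trivial
      exact hLB.false_of_in h
    · obtain ⟨_, h⟩ := hv₁.join hv₂ (iff_of_false hcol hAZ) trivial
      exact hLB.false_of_in h

/-- If all other parents of `A` are parents of `L`, and `D → L` is an edge from a node that is not
a parent of `A`, then one of the edges `D → L` and `L → A` is deletable. Otherwise `G`-active walks
from `A` and from `D` to `L` meet in a collider at the leaf `L`, although `H` separates `A` and `D`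
by `L` and the other parents of `L`. -/
theorem dsep_or_dsep_of_parent_of_leaf {G H : DAG V} (hGH : IMapLE G H) {L A D : V}
    (hL : G.IsLeaf L) (hA : H.IsHighestChild L A) (hpa : ∀ p, H.edge p A → p ≠ L → H.edge p L)
    (hDL : H.edge D L) (hD : ¬ H.edge D A) :
    G.DSep L D {p | H.edge p L ∧ p ≠ D} ∨ G.DSep A L {p | H.edge p A ∧ p ≠ L} := by
  by_contra hcon
  push Not at hcon
  obtain ⟨hLD, hAL⟩ := hcon
  simp only [DSep, not_forall, not_not] at hLD hAL
  obtain ⟨u₂, h₂⟩ := hLD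
  obtain ⟨u₁, h₁⟩ := hAL
  set Z : Set V := insert L {p | H.edge p L ∧ p ≠ D} with hZ
  have hdesc : ∀ p, H.edge p L → ¬ H.IsDescendant A p := fun p hp h =>
    H.not_isDescendant_of_edge hp (Relation.ReflTransGen.head hA.1 h)
  have hAD : G.DSep A D Z := by
    refine hGH.dsep_of_parents_subset ?_ ?_ (hdesc D hDL) ?_
    · intro p hp
      by_cases hpL : p = L
      · exact .inl hpL
      · exact .inr ⟨hpa p hp hpL, by rintro rfl; exact hD hp⟩
    · rintro z (rfl | hz)
      exacts [H.not_isDescendant_of_edge hA.1, hdesc z hz.1]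
    · rintro (rfl | h)
      exacts [H.not_edge_self _ hDL, h.2 rfl]
  have hw₁ : ∃ w, G.ActivePathIn {p | H.edge p A ∧ p ≠ L} (Set.univ \ {L}) A w L := by
    rcases h₁.toIn.firstHit {L} with h | ⟨_, rfl, -, w, h⟩
    exacts [⟨_, h⟩, ⟨_, h⟩]
  obtain ⟨w₁, hw₁⟩ := hw₁
  set N : Set V := {q | ¬ H.IsDescendant L q ∧ ¬ H.edge q A} with hN
  have hw₁' : G.ActivePathIn Z Set.univ A w₁ L := by
    rcases hw₁.firstHit N with h | ⟨q, hq, -, w, h⟩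
    · refine h.congr (Set.subset_univ _) ?_
      rintro v ⟨⟨-, hvL⟩, hvN⟩
      constructor
      · rintro ⟨h1, h2⟩
        exact .inr ⟨hpa v h1 h2, by rintro rfl; exact hD h1⟩
      · rintro (h | h)
        · exact absurd h hvL
        · refine ⟨?_, hvL⟩
          by_contra hvA
          exact hvN ⟨H.not_isDescendant_of_edge h.1, hvA⟩
    · refine ((hA.dsep hGH hq.1 hq.2).false_of_in (h.congr subset_rfl ?_)).elim
      rintro v ⟨⟨-, hvL⟩, -⟩
      exact ⟨fun h => h.1, fun h => ⟨h, hvL⟩⟩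
  have hw₂ : ∃ w, G.ActivePathIn Z Set.univ D w L := by
    obtain ⟨u, hu⟩ := h₂.toIn.symm
    have hag : ∀ v ∈ Set.univ \ {L}, v ∈ {p | H.edge p L ∧ p ≠ D} ↔ v ∈ Z := by
      rintro v ⟨-, hv⟩
      exact ⟨.inr, fun h => h.resolve_left hv⟩
    rcases hu.firstHit {L} with h | ⟨_, rfl, -, w, h⟩
    exacts [⟨_, h.congr (Set.subset_univ _) hag⟩, ⟨_, h.congr (Set.subset_univ _) hag⟩]
  obtain ⟨w₂, hw₂⟩ := hw₂
  -- Every edge at the leaf `L` points into it.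
  have into : ∀ {a w}, G.ActivePathIn Z Set.univ a w L → G.edge w L := by
    intro a w h
    cases h with
    | single h => exact h.resolve_right (hL _)
    | step _ h _ _ => exact h.resolve_right (hL _)
  obtain ⟨_, h⟩ := hw₁'.join hw₂ (iff_of_true ⟨into hw₁', into hw₂⟩ (.inl rfl)) trivial
  exact hAD.false_of_in h

end DAG

theorem mainTheorem3 {V : Type*} [Finite V] (G H : DAG V) (hGH : DAG.IMapLE G H)
    (L : DAG.prune G H)
    (hL : DAG.IsLowestLeaf (G.induce (DAG.prune G H)) (H.induce (DAG.prune G H)) L) :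
    ((∀ C : DAG.prune G H, ¬ (H.induce (DAG.prune G H)).edge L C) →
      ∀ D : DAG.prune G H, (H.induce (DAG.prune G H)).edge D L →
        ¬ (G.induce (DAG.prune G H)).edge D L → DAG.Deletable G H D L) ∧
    (∀ A : DAG.prune G H, (H.induce (DAG.prune G H)).IsHighestChild L A →
      H.Covered L A ∨
      (∃ B : V, H.edge B A ∧ B ≠ L ∧ ¬ H.Adj L B ∧
        (DAG.Deletable G H L A ∨ DAG.Deletable G H B A)) ∨
      (∃ D : V, H.edge D L ∧ D ≠ A ∧ ¬ H.Adj D A ∧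
        (DAG.Deletable G H D L ∨ DAG.Deletable G H L A))) := by
  obtain ⟨hG, hH⟩ := DAG.isAncestral_prune G H
  have hGH' := hGH.induce hG hH
  refine ⟨fun hleaf D hDL hDG => hGH.deletable_of_induce hG hH hDL
    (DAG.dsep_of_isLeaf hGH' hL.1 hleaf hDG), fun A hA => ?_⟩
  by_cases hpa : ∀ p, H.edge p A → p ≠ L → H.edge p L
  · by_cases hpa' : ∀ p, H.edge p L → H.edge p A
    · refine .inl ⟨hA.1, fun p => ⟨fun h => ?_, ?_⟩⟩
      · by_cases hp : p = L
        exacts [.inr hp, .inl (hpa p h hp)]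
      · rintro (h | rfl)
        exacts [hpa' p h, hA.1]
    · push Not at hpa'
      obtain ⟨D, hDL, hDA⟩ := hpa'
      have hAD : ¬ H.edge A D := fun h =>
        H.acyclic D (((Relation.TransGen.single hDL).tail hA.1).tail h)
      refine .inr (.inr ⟨D, hDL, ?_, fun h => h.elim hDA hAD, ?_⟩)
      · rintro rfl
        exact H.edge_asymm hDL hA.1
      · lift D to DAG.prune G H using hH _ _ hDL L.2
        refine (DAG.dsep_or_dsep_of_parent_of_leaf hGH' hL.1 hA
          (fun p hp hpL => hpa p hp fun e => hpL (Subtype.ext e)) hDL hDA).imp ?_ ?_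
        · exact hGH.deletable_of_induce hG hH hDL
        · exact hGH.deletable_of_induce hG hH hA.1
  · push Not at hpa
    obtain ⟨B, hBA, hBL, hB⟩ := hpa
    lift B to DAG.prune G H using hH _ _ hBA A.2
    have hBL' : B ≠ L := fun e => hBL (congrArg Subtype.val e)
    have hLB : ¬ H.edge L B := fun h =>
      hA.not_isProperDescendant_of_edge (p := B) hBA ⟨.single h, hBL'⟩
    refine .inr (.inl ⟨B, hBA, hBL, fun h => h.elim hLB hB, ?_⟩)
    refine (DAG.dsep_or_dsep_of_parent_of_child hGH' hL hA hBA hBL' hB).imp ?_ ?_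
    · exact hGH.deletable_of_induce hG hH hA.1
    · exact hGH.deletable_of_induce hG hH hBA
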